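/- Let $\Theta_0\in\mathbb{C}^{p\times p}$ be Hermitian positive definite, $\Theta_0=\Lambda\Lambda^H$ with $\Lambda\in\mathbb{C}^{p\times q}$, and let $x_1,x_2,\dots$ be i.i.d. complex angular elliptical vectors with shape matrix $\Theta_0$, i.e. each $x_i$ is distributed as $\Lambda u/\|\Lambda u\|_2$ with $u$ uniform on the unit sphere of $\mathbb{C}^q$. Let $\|\cdot\|$ be any norm on $\mathbb{C}^{p\times p}$. For a set $\mathcal{S}'$ of Hermitian positive semidefinite $p\times p$ matrices with $\Theta_0\in\mathcal{S}'$, the COCA program with $n$ samples is $$\min_{\Theta\in\mathcal{S}',\,d_1,\dots,d_n\in\mathbb{R}}\ \Big\|\Theta-\frac1n\sum_{i=1}^n d_i x_i x_i^H\Big\|\quad\text{subject to}\quad \Theta\succeq\frac1p\, d_i x_i x_i^H,\ \ d_i>0,\quad i=1,\dots,n.$$ Call $(\widehat\Theta^{(n)})_n$ a COCA sequence if there are real $\varepsilon_n\to0$ such that, for all large $n$, $\widehat\Theta^{(n)}$ is the $\Theta$-part of a feasible point whose objective value is at most $\varepsilon_n$ above that of every feasible point (exact solutions are the case $\varepsilon_n=0$).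 (i) Let $\mathcal{S}'$ be the set of positive semidefinite matrices in the affine set $\{D_0+\sum_{i=1}^k a_iD_i: a_i\in\mathbb{R}\}$, where $D_0\succeq0$ and $D_1,\dots,D_k$ are Hermitian with $\operatorname{Tr}D_i=0$ (so that the trace is fixed on $\mathcal{S}'$). Then COCA sequences exist for every sample sequence, and almost surely every COCA sequence satisfies $\widehat\Theta^{(n)}\to\Theta_0$ as $n\to\infty$. (ii) Let $\mathcal{S}'$ be any closed convex set of positive semidefinite matrices with $0\notin\mathcal{S}'$. Then COCA sequences exist for every sample sequence, and almost surely every COCA sequence converges to $\Theta_0$ up to scale: $\frac{\operatorname{Tr}\Theta_0}{\operatorname{Tr}\widehat\Theta^{(n)}}\,\widehat\Theta^{(n)}\to\Theta_0$ as $n\to\infty$. -/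

import Mathlib

open MeasureTheory ProbabilityTheory Filter Topology
open scoped ComplexOrder

noncomputable section

/-- The uniform distribution on the unit sphere of `ℂ^q`: the surface measure, normalized to total
mass one and regarded as a measure on `ℂ^q`. -/
def uniformSphere (q : ℕ) : Measure (EuclideanSpace ℂ (Fin q)) :=
  let σ := (Measure.addHaar : Measure (EuclideanSpace ℂ (Fin q))).toSphere
  Measure.map (fun u : Metric.sphere (0 : EuclideanSpace ℂ (Fin q)) 1 => u.1) ((σ Set.univ)⁻¹ • σ)

/-- The complex angular elliptical distribution with shape matrix `Λ Λᴴ`: the law of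
`Λ u / ‖Λ u‖` (Euclidean norm), where `u` is uniformly distributed on the unit sphere of `ℂ^q`. -/
def angularElliptical {p q : ℕ} (Λ : Matrix (Fin p) (Fin q) ℂ) :
    Measure (EuclideanSpace ℂ (Fin p)) :=
  Measure.map
    (fun u : EuclideanSpace ℂ (Fin q) =>
      (‖WithLp.toLp 2 (Λ.mulVec u.ofLp)‖⁻¹ : ℝ) • WithLp.toLp 2 (Λ.mulVec u.ofLp))
    (uniformSphere q)

/-- The rank-one matrix `x xᴴ`. -/
def outerSelf {p : ℕ} (x : EuclideanSpace ℂ (Fin p)) : Matrix (Fin p) (Fin p) ℂ :=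
  Matrix.vecMulVec x.ofLp (star x.ofLp)

/-- The positive semidefinite matrices in the real affine space `D₀ + span {D₁, …, D_k}`. -/
def affineStructure {p k : ℕ} (D₀ : Matrix (Fin p) (Fin p) ℂ)
    (D : Fin k → Matrix (Fin p) (Fin p) ℂ) : Set (Matrix (Fin p) (Fin p) ℂ) :=
  {Θ | Θ.PosSemidef ∧ ∃ a : Fin k → ℝ, Θ = D₀ + ∑ i, a i • D i}

/-- Feasible points of the COCA program with structure set `S` and samples `x₁, …, x_n`. -/
structure IsCOCAFeasible {p n : ℕ} (S : Set (Matrix (Fin p) (Fin p) ℂ))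
    (x : Fin n → EuclideanSpace ℂ (Fin p)) (Θ : Matrix (Fin p) (Fin p) ℂ) (d : Fin n → ℝ) :
    Prop where
  mem : Θ ∈ S
  lmi : ∀ i, (Θ - (1 / (p : ℝ) * d i) • outerSelf (x i)).PosSemidef
  pos : ∀ i, 0 < d i

/-- The objective `‖Θ - (1/n) ∑ dᵢ xᵢ xᵢᴴ‖` of the COCA program, for the norm `N`. -/
def cocaObjective {p n : ℕ} (N : Seminorm ℝ (Matrix (Fin p) (Fin p) ℂ))
    (x : Fin n → EuclideanSpace ℂ (Fin p)) (Θ : Matrix (Fin p) (Fin p) ℂ) (d : Fin n → ℝ) : ℝ :=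
  N (Θ - (1 / (n : ℝ)) • ∑ i, d i • outerSelf (x i))

/-- Solutions of the COCA program up to an error `ε` in the objective; `ε = 0` gives the exact
solutions. -/
structure IsCOCASolution {p n : ℕ} (N : Seminorm ℝ (Matrix (Fin p) (Fin p) ℂ))
    (S : Set (Matrix (Fin p) (Fin p) ℂ)) (x : Fin n → EuclideanSpace ℂ (Fin p)) (ε : ℝ)
    (Θ : Matrix (Fin p) (Fin p) ℂ) (d : Fin n → ℝ) : Prop where
  feasible : IsCOCAFeasible S x Θ d
  le : ∀ Θ' d', IsCOCAFeasible S x Θ' d' → cocaObjective N x Θ d ≤ cocaObjective N x Θ' d' + ε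

/-- `Θ n` is, for all large `n`, a COCA estimate from the first `n` terms of the sample sequence
`y`, up to an error in the objective that vanishes as `n → ∞`. Sequences of exact solutions are
included (`ε = 0`); an error is allowed because the constraints `dᵢ > 0` are strict, so that the
minimum need not be attained. -/
def IsCOCASequence {p : ℕ} (N : Seminorm ℝ (Matrix (Fin p) (Fin p) ℂ))
    (S : Set (Matrix (Fin p) (Fin p) ℂ)) (y : ℕ → EuclideanSpace ℂ (Fin p))
    (Θ : ℕ → Matrix (Fin p) (Fin p) ℂ) : Prop :=
  ∃ (d : (n : ℕ) → Fin n → ℝ) (ε : ℕ → ℝ), Tendsto ε atTop (𝓝 0) ∧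
    ∀ᶠ n in atTop, IsCOCASolution N S (fun i : Fin n => y i) (ε n) (Θ n) (d n)

end

/-! Factor `Θ₀ = L Lᴴ` and whiten by `Li = L⁻¹`: the directions `z i` of `Li (y i)` have the angular
law of `W = Li Λ`, where `W Wᴴ = 1`. This law is invariant under unitary matrices, so its second
moment matrix is `(1/p) I`.

The optimal value tends to zero. With `r i = ‖Li (y i)‖`, the point `Θ₀`, `d i = p / r i ^ 2` is
feasible, and in whitened coordinates its residual is `I - (1/n) ∑ p z zᴴ`, which vanishes by the
law of large numbers. Hence near-optimal residuals vanish too. A lower bound on the traces over `S`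
keeps this true after rescaling the estimates to the trace of `Θ₀`, and compactness then leaves only
cluster points `T` to identify (`HasEmpiricalLaw.tendsto_shape`).

Suppose the whitened `T`, diagonalized with eigenvalues `l`, has a largest eigenvalue `l j` and some
`l k < l j`. The semidefinite constraints bound each multiplier asymptotically by `p * l j / (1 + κ
|a_k|²)` with `κ > 0`, where `a` is the direction in the eigenbasis (`multiplier_le_of_posSemidef`).
The vanishing residual, read at the entry `(j, j)`, forces `1/p ≤ E[|a_j|² / (1 + κ |a_k|²)]`
(`one_div_le_of_tendsto_diagonal`). But this expectation is strictly below `E|a_j|² = 1/p`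
(`integral_norm_sq_div_lt`). So all eigenvalues agree, `T` is a multiple of `Θ₀`, and the trace
makes the multiple one.

The eigenbasis depends on the sample. The almost sure event is therefore chosen to serve all
continuous test functions simultaneously, and unitary invariance makes the limiting expectation
independent of the basis. -/

/-! ### Rotation invariance of the uniform distribution on the sphere -/

-- The image of `m` under `V` is again a Haar measure and gives the unit ball the same finite,
-- positive mass, so it equals `m`. The surface measure of a set is defined through the volume of
-- the cone over it, and `V` commutes with taking cones.
open scoped Pointwise in
theorem toSphere_preimage_linearIsometryEquiv {E : Type*} [NormedAddCommGroup E] [NormedSpace ℝ E]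
    [MeasurableSpace E] [BorelSpace E] [FiniteDimensional ℝ E] (m : Measure E) [m.IsAddHaarMeasure]
    (V : E ≃ₗᵢ[ℝ] E) (s : Set E) (hs : MeasurableSet s) :
    m.toSphere {u | V u.1 ∈ s} = m.toSphere {u | u.1 ∈ s} := by
  have hV : Measurable V := V.continuous.measurable
  have hinv : m.map V = m := by
    have h1 : (m.map V).IsAddHaarMeasure := V.toContinuousLinearEquiv.isAddHaarMeasure_map m
    have h2 := Measure.isAddLeftInvariant_eq_smul (m.map V) m
    have h3 : (m.map V) (Metric.ball 0 1) = m (Metric.ball 0 1) := by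
      rw [Measure.map_apply hV Metric.isOpen_ball.measurableSet]
      congr 1
      ext x
      simp
    have h4 : m (Metric.ball (0 : E) 1) ≠ 0 := (Metric.measure_ball_pos m _ one_pos).ne'
    have h5 : m (Metric.ball (0 : E) 1) ≠ ⊤ := measure_ball_lt_top.ne
    rw [h2] at h3
    have h6 : (((m.map V).addHaarScalarFactor m : NNReal) : ENNReal) = 1 := by
      rw [Measure.smul_apply, ENNReal.smul_def, smul_eq_mul] at h3
      exact (ENNReal.mul_eq_right h4 h5).1 h3
    rw [h2]
    have h7 : (m.map V).addHaarScalarFactor m = 1 := by exact_mod_cast h6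
    rw [h7, one_smul]
  have hs' : MeasurableSet {u : Metric.sphere (0 : E) 1 | u.1 ∈ s} := measurable_subtype_coe hs
  have hVs : MeasurableSet {u : Metric.sphere (0 : E) 1 | V u.1 ∈ s} :=
    (hV.comp measurable_subtype_coe) hs
  rw [Measure.toSphere_apply' _ hVs, Measure.toSphere_apply' _ hs']
  congr 1
  have hT : ∀ A : Set E, MeasurableSet A →
      MeasurableSet (Set.Ioo (0 : ℝ) 1 • (Subtype.val '' {u : Metric.sphere (0 : E) 1 | u.1 ∈ A})) := by
    intro A hA
    have : Set.Ioo (0 : ℝ) 1 • (Subtype.val '' {u : Metric.sphere (0 : E) 1 | u.1 ∈ A})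
        = {x : E | 0 < ‖x‖ ∧ ‖x‖ < 1 ∧ ‖x‖⁻¹ • x ∈ A} := by
      ext x
      simp only [Set.mem_smul, Set.mem_image, Set.mem_ofPred_eq, Subtype.exists]
      constructor
      · rintro ⟨r, hr, _, ⟨y, hy, hyA, rfl⟩, rfl⟩
        have hy1 : ‖y‖ = 1 := by simpa using hy
        have : ‖r • y‖ = r := by rw [norm_smul, hy1, mul_one, Real.norm_of_nonneg hr.1.le]
        rw [this, smul_smul, inv_mul_cancel₀ hr.1.ne', one_smul]
        exact ⟨hr.1, hr.2, hyA⟩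
      · rintro ⟨h0, h1, hA⟩
        refine ⟨‖x‖, ⟨h0, h1⟩, ‖x‖⁻¹ • x, ⟨‖x‖⁻¹ • x, ?_, hA, rfl⟩, ?_⟩
        · simp [norm_smul, h0.ne']
        · rw [smul_smul, mul_inv_cancel₀ h0.ne', one_smul]
    rw [this]
    exact (measurableSet_lt measurable_const measurable_norm).inter
      ((measurableSet_lt measurable_norm measurable_const).inter
        ((measurable_norm.inv.smul measurable_id) hA))
  have key : Set.Ioo (0 : ℝ) 1 • (Subtype.val '' {u : Metric.sphere (0 : E) 1 | V u.1 ∈ s})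
      = V ⁻¹' (Set.Ioo (0 : ℝ) 1 • (Subtype.val '' {u : Metric.sphere (0 : E) 1 | u.1 ∈ s})) := by
    ext x
    simp only [Set.mem_smul, Set.mem_image, Set.mem_ofPred_eq, Subtype.exists, Set.mem_preimage]
    constructor
    · rintro ⟨r, hr, _, ⟨y, hy, hyA, rfl⟩, rfl⟩
      exact ⟨r, hr, V y, ⟨V y, by simpa using hy, hyA, rfl⟩, by simp⟩
    · rintro ⟨r, hr, _, ⟨y, hy, hyA, rfl⟩, hx⟩
      refine ⟨r, hr, V.symm y, ⟨V.symm y, by simpa using hy, by simpa using hyA, rfl⟩, ?_⟩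
      apply V.injective
      simpa using hx
  rw [key, ← Measure.map_apply hV (hT s hs), hinv]

theorem uniformSphere_apply {q : ℕ} (s : Set (EuclideanSpace ℂ (Fin q))) (hs : MeasurableSet s) :
    uniformSphere q s =
      ((Measure.addHaar : Measure (EuclideanSpace ℂ (Fin q))).toSphere Set.univ)⁻¹ *
        (Measure.addHaar : Measure (EuclideanSpace ℂ (Fin q))).toSphere {u | u.1 ∈ s} := by
  rw [uniformSphere, Measure.map_apply measurable_subtype_coe hs]
  rfl

/-- The uniform distribution on the sphere is invariant under linear isometries. -/
theorem uniformSphere_map {q : ℕ} (V : EuclideanSpace ℂ (Fin q) ≃ₗᵢ[ℝ] EuclideanSpace ℂ (Fin q)) :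
    (uniformSphere q).map V = uniformSphere q := by
  ext s hs
  rw [Measure.map_apply V.continuous.measurable hs, uniformSphere_apply _ hs,
    uniformSphere_apply _ (V.continuous.measurable hs)]
  congr 1
  exact toSphere_preimage_linearIsometryEquiv _ V s hs

open scoped Pointwise in
/-- Proper real subspaces are null sets of the uniform distribution on the sphere. -/
theorem uniformSphere_submodule {q : ℕ} (K : Submodule ℝ (EuclideanSpace ℂ (Fin q))) (hK : K ≠ ⊤) :
    uniformSphere q K = 0 := by
  have hm : MeasurableSet (K : Set (EuclideanSpace ℂ (Fin q))) :=
    K.closed_of_finiteDimensional.measurableSet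
  have hm' : MeasurableSet {u : Metric.sphere (0 : EuclideanSpace ℂ (Fin q)) 1 | u.1 ∈
      (K : Set (EuclideanSpace ℂ (Fin q)))} := measurable_subtype_coe hm
  rw [uniformSphere_apply _ hm, Measure.toSphere_apply' _ hm']
  have : Set.Ioo (0 : ℝ) 1 • (Subtype.val '' {u : Metric.sphere (0 : EuclideanSpace ℂ (Fin q)) 1 | u.1 ∈
      (K : Set (EuclideanSpace ℂ (Fin q)))}) ⊆ K := by
    rintro _ ⟨r, -, _, ⟨u, hu, rfl⟩, rfl⟩
    exact K.smul_mem r hu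
  rw [measure_mono_null this (Measure.addHaar_submodule _ K hK)]
  simp

/-! ### Simultaneous law of large numbers -/

/-- A law of large numbers along all continuous test functions at once. -/
theorem ae_forall_continuous_tendsto_average {E Ω : Type*} [NormedAddCommGroup E]
    [ProperSpace E] [SecondCountableTopology E] [MeasurableSpace E] [BorelSpace E]
    [MeasurableSpace Ω] {μ : Measure Ω} [IsProbabilityMeasure μ] {ν : Measure E}
    {X : ℕ → Ω → E} (hlaw : ∀ i, HasLaw (X i) ν μ) (hindep : iIndepFun X μ)
    (hν : ∀ᵐ z ∂ν, ‖z‖ = 1) :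
    ∀ᵐ ω ∂μ, (∀ i, ‖X i ω‖ = 1) ∧ ∀ g : E → ℝ, Continuous g →
      Tendsto (fun n : ℕ => (∑ i ∈ Finset.range n, g (X i ω)) / n) atTop (𝓝 (∫ z, g z ∂ν)) := by
  have hprob : IsProbabilityMeasure ν :=
    (hlaw 0).isProbabilityMeasure_iff.1 inferInstance
  have hint : ∀ g : E → ℝ, Continuous g → Integrable g ν := by
    intro g hg
    obtain ⟨C, hC⟩ := (isCompact_closedBall (0 : E) 1).exists_bound_of_continuousOn hg.continuousOn
    refine Integrable.of_bound hg.aestronglyMeasurable C ?_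
    filter_upwards [hν] with z hz
    exact hC z (by simp [hz])
  have hone : ∀ᵐ ω ∂μ, ∀ i, ‖X i ω‖ = 1 := by
    rw [ae_all_iff]
    intro i
    exact ((hlaw i).ae_iff (p := fun z => ‖z‖ = 1)
      (measurableSet_eq_fun measurable_norm measurable_const).mem).2 hν
  have hslln : ∀ f : C(E, ℝ), ∀ᵐ ω ∂μ,
      Tendsto (fun n : ℕ => (∑ i ∈ Finset.range n, f (X i ω)) / n) atTop (𝓝 (∫ z, f z ∂ν)) := by
    intro f
    have hid : ∀ i, IdentDistrib (fun ω => f (X i ω)) (fun ω => f (X 0 ω)) μ μ := fun i =>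
      ((hlaw i).identDistrib (hlaw 0)).comp f.continuous.measurable
    have h0 : Integrable (fun ω => f (X 0 ω)) μ := by
      have h := hint f f.continuous
      rw [← (hlaw 0).map_eq] at h
      exact h.comp_aemeasurable (hlaw 0).aemeasurable
    have := strong_law_ae_real (μ := μ) (fun i ω => f (X i ω)) h0
      (fun i j hij => (hindep.indepFun hij).comp f.continuous.measurable f.continuous.measurable)
      hid
    rwa [← (hlaw 0).integral_comp f.continuous.aestronglyMeasurable]
  -- Only countably many test functions are needed: a dense sequence for uniform convergence on
  -- compacts, the samples staying in the closed unit ball.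
  filter_upwards [hone, ae_all_iff.2 fun m => hslln (TopologicalSpace.denseSeq C(E, ℝ) m)]
    with ω h1 h2
  refine ⟨h1, fun g hg => ?_⟩
  rw [Metric.tendsto_atTop]
  intro ε hε
  obtain ⟨m, hm⟩ : ∃ m, ∀ z ∈ Metric.closedBall (0 : E) 1,
      dist (g z) (TopologicalSpace.denseSeq C(E, ℝ) m z) < ε / 4 := by
    have h3 := ContinuousMap.tendsto_iff_forall_isCompact_tendstoUniformlyOn.1
      (tendsto_id (x := 𝓝 (⟨g, hg⟩ : C(E, ℝ)))) _ (isCompact_closedBall (0 : E) 1)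
    have h4 := Metric.tendstoUniformlyOn_iff.1 h3 (ε / 4) (by positivity)
    obtain ⟨_, ⟨m, rfl⟩, hf⟩ := (TopologicalSpace.denseRange_denseSeq C(E, ℝ)).inter_nhds_nonempty h4
    exact ⟨m, hf⟩
  set f := TopologicalSpace.denseSeq C(E, ℝ) m
  obtain ⟨n₀, hn₀⟩ := Metric.tendsto_atTop.1 (h2 m) (ε / 4) (by positivity)
  refine ⟨n₀ + 1, fun n hn => ?_⟩
  have hn0 : (0 : ℝ) < n := by exact_mod_cast (by omega : 0 < n)
  have e1 : |(∑ i ∈ Finset.range n, g (X i ω)) / n - (∑ i ∈ Finset.range n, f (X i ω)) / n|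
      ≤ ε / 4 := by
    rw [← sub_div, ← Finset.sum_sub_distrib, abs_div, abs_of_pos hn0, div_le_iff₀ hn0]
    refine (Finset.abs_sum_le_sum_abs _ _).trans ?_
    refine (Finset.sum_le_card_nsmul _ _ (ε / 4) fun i _ => ?_).trans ?_
    · exact (hm _ (by simp [h1 i])).le
    · simp [mul_comm]
  have e2 : |(∫ z, f z ∂ν) - ∫ z, g z ∂ν| ≤ ε / 4 := by
    rw [← integral_sub (hint f f.continuous) (hint g hg)]
    have := norm_integral_le_of_norm_le_const (μ := ν) (f := fun z => f z - g z) (C := ε / 4) (by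
      filter_upwards [hν] with z hz
      have := (hm z (by simp [hz])).le
      rwa [dist_comm] at this)
    simpa using this
  have e3 := hn₀ n (by omega)
  rw [Real.dist_eq] at e3 ⊢
  rw [abs_lt] at e3 ⊢
  rw [abs_le] at e1 e2
  constructor <;> linarith [e1.1, e1.2, e2.1, e2.2, e3.1, e3.2]

/-! ### Whitening and central angular elliptical laws -/

/-- The action of a matrix on column vectors with the Euclidean norm. -/
def euclideanMulVec {m n : ℕ} (M : Matrix (Fin m) (Fin n) ℂ) (x : EuclideanSpace ℂ (Fin n)) :
    EuclideanSpace ℂ (Fin m) :=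
  WithLp.toLp 2 (M.mulVec x.ofLp)

theorem continuous_euclideanMulVec {m n : ℕ} (M : Matrix (Fin m) (Fin n) ℂ) :
    Continuous (euclideanMulVec M) := by
  unfold euclideanMulVec
  fun_prop

theorem euclideanMulVec_mul {l m n : ℕ} (M : Matrix (Fin l) (Fin m) ℂ)
    (M' : Matrix (Fin m) (Fin n) ℂ) (x : EuclideanSpace ℂ (Fin n)) :
    euclideanMulVec (M * M') x = euclideanMulVec M (euclideanMulVec M' x) := by
  simp [euclideanMulVec, Matrix.mulVec_mulVec]

theorem euclideanMulVec_smul {m n : ℕ} (M : Matrix (Fin m) (Fin n) ℂ) (r : ℝ)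
    (x : EuclideanSpace ℂ (Fin n)) :
    euclideanMulVec M (r • x) = r • euclideanMulVec M x := by
  simp [euclideanMulVec, Matrix.mulVec_smul]

theorem euclideanMulVec_add {m n : ℕ} (M : Matrix (Fin m) (Fin n) ℂ)
    (x y : EuclideanSpace ℂ (Fin n)) :
    euclideanMulVec M (x + y) = euclideanMulVec M x + euclideanMulVec M y := by
  simp [euclideanMulVec, Matrix.mulVec_add]

@[simp]
theorem euclideanMulVec_zero {m n : ℕ} (M : Matrix (Fin m) (Fin n) ℂ) :
    euclideanMulVec M 0 = 0 := by
  simp [euclideanMulVec]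

theorem norm_sq_eq_dotProduct {n : ℕ} (x : EuclideanSpace ℂ (Fin n)) :
    ((‖x‖ ^ 2 : ℝ) : ℂ) = star x.ofLp ⬝ᵥ x.ofLp := by
  rw [EuclideanSpace.norm_sq_eq, dotProduct]
  push_cast
  refine Finset.sum_congr rfl fun i _ => ?_
  rw [Pi.star_apply, RCLike.star_def, Complex.conj_mul']

theorem norm_euclideanMulVec {m n : ℕ} {U : Matrix (Fin m) (Fin n) ℂ} (hU : U.conjTranspose * U = 1)
    (x : EuclideanSpace ℂ (Fin n)) : ‖euclideanMulVec U x‖ = ‖x‖ := by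
  have h : ((‖euclideanMulVec U x‖ ^ 2 : ℝ) : ℂ) = ((‖x‖ ^ 2 : ℝ) : ℂ) := by
    rw [norm_sq_eq_dotProduct, norm_sq_eq_dotProduct]
    simp only [euclideanMulVec]
    rw [Matrix.star_mulVec, ← Matrix.dotProduct_mulVec, Matrix.mulVec_mulVec, hU, Matrix.one_mulVec]
  have h2 : ‖euclideanMulVec U x‖ ^ 2 = ‖x‖ ^ 2 := by exact_mod_cast h
  exact (sq_eq_sq₀ (norm_nonneg _) (norm_nonneg _)).1 h2

theorem uniformSphere_map_euclideanMulVec {q : ℕ} {V : Matrix (Fin q) (Fin q) ℂ}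
    (hV : V.conjTranspose * V = 1) :
    (uniformSphere q).map (euclideanMulVec V) = uniformSphere q := by
  let f : EuclideanSpace ℂ (Fin q) →ₗᵢ[ℝ] EuclideanSpace ℂ (Fin q) :=
    { toFun := euclideanMulVec V
      map_add' := euclideanMulVec_add V
      map_smul' := fun r x => euclideanMulVec_smul V r x
      norm_map' := norm_euclideanMulVec hV }
  exact uniformSphere_map (f.toLinearIsometryEquiv rfl)

/-- The direction of `M x`. -/
noncomputable def normalizedImage {m n : ℕ} (M : Matrix (Fin m) (Fin n) ℂ) (x : EuclideanSpace ℂ (Fin n)) :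
    EuclideanSpace ℂ (Fin m) :=
  (‖euclideanMulVec M x‖⁻¹ : ℝ) • euclideanMulVec M x

theorem measurable_normalizedImage {m n : ℕ} (M : Matrix (Fin m) (Fin n) ℂ) :
    Measurable (normalizedImage M) := by
  have := (continuous_euclideanMulVec M).measurable
  unfold normalizedImage
  fun_prop

theorem angularElliptical_eq_map {p q : ℕ} (Λ : Matrix (Fin p) (Fin q) ℂ) :
    angularElliptical Λ = (uniformSphere q).map (normalizedImage Λ) := rfl

theorem norm_smul_normalizedImage {m n : ℕ} (M : Matrix (Fin m) (Fin n) ℂ)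
    (x : EuclideanSpace ℂ (Fin n)) :
    ‖euclideanMulVec M x‖ • normalizedImage M x = euclideanMulVec M x := by
  rcases eq_or_ne (euclideanMulVec M x) 0 with h | h
  · simp [h]
  · rw [normalizedImage, smul_smul, mul_inv_cancel₀ (norm_ne_zero_iff.2 h), one_smul]

theorem normalizedImage_normalizedImage {l m n : ℕ} (M : Matrix (Fin l) (Fin m) ℂ)
    (M' : Matrix (Fin m) (Fin n) ℂ) (x : EuclideanSpace ℂ (Fin n)) :
    normalizedImage M (normalizedImage M' x) = normalizedImage (M * M') x := by
  rcases eq_or_ne (euclideanMulVec M' x) 0 with h | h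
  · simp [normalizedImage, euclideanMulVec_mul, h]
  · have h' : ‖euclideanMulVec M' x‖ ≠ 0 := norm_ne_zero_iff.2 h
    simp only [normalizedImage, euclideanMulVec_mul, euclideanMulVec_smul, norm_smul, norm_inv,
      norm_norm, smul_smul, mul_inv, inv_inv]
    congr 1
    field_simp

theorem angularElliptical_map_normalizedImage {p q r : ℕ} (M : Matrix (Fin r) (Fin p) ℂ)
    (Λ : Matrix (Fin p) (Fin q) ℂ) :
    (angularElliptical Λ).map (normalizedImage M) = angularElliptical (M * Λ) := by
  rw [angularElliptical_eq_map, angularElliptical_eq_map,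
    Measure.map_map (measurable_normalizedImage M) (measurable_normalizedImage Λ)]
  congr 1
  ext1 x
  exact normalizedImage_normalizedImage M Λ x

/-- Central angular elliptical laws are unitarily invariant. -/
theorem angularElliptical_map_euclideanMulVec {p q : ℕ} {W : Matrix (Fin p) (Fin q) ℂ}
    (hW : W * W.conjTranspose = 1) {V : Matrix (Fin p) (Fin p) ℂ} (hV : V.conjTranspose * V = 1) :
    (angularElliptical W).map (euclideanMulVec V) = angularElliptical W := by
  -- `V'` is the lift of `V` to `ℂ^q`: it acts as `V` on the range of `Wᴴ`, identified with `ℂ^p`,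
  -- and as the identity on the kernel of `W`. So it is unitary and intertwines: `W V' = V W`.
  set V' : Matrix (Fin q) (Fin q) ℂ :=
    W.conjTranspose * V * W + (1 - W.conjTranspose * W) with hV'def
  have hWV : W * V' = V * W := by
    have : W * V' = (W * W.conjTranspose) * V * W + (W - (W * W.conjTranspose) * W) := by
      rw [hV'def]
      simp only [Matrix.mul_add, Matrix.mul_sub, Matrix.mul_one, Matrix.mul_assoc]
    rw [this, hW]; simp
  have hV' : V'.conjTranspose * V' = 1 := by
    have e1 : V'.conjTranspose = W.conjTranspose * V.conjTranspose * W
        + (1 - W.conjTranspose * W) := by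
      simp [hV'def, Matrix.conjTranspose_mul, Matrix.mul_assoc]
    have e2 : V'.conjTranspose * V' = W.conjTranspose * V.conjTranspose * (W * V')
        + (V' - W.conjTranspose * (W * V')) := by
      rw [e1]
      simp only [Matrix.add_mul, Matrix.sub_mul, Matrix.one_mul, Matrix.mul_assoc]
    have e3 : W.conjTranspose * V.conjTranspose * (V * W) = W.conjTranspose * W := by
      have : W.conjTranspose * V.conjTranspose * (V * W)
          = W.conjTranspose * (V.conjTranspose * V) * W := by
        simp only [Matrix.mul_assoc]
      rw [this, hV, Matrix.mul_one]
    rw [e2, hWV, e3, hV'def, Matrix.mul_assoc]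
    abel
  have hcomm : euclideanMulVec V ∘ normalizedImage W = normalizedImage W ∘ euclideanMulVec V' := by
    ext1 u
    simp only [Function.comp_apply, normalizedImage, euclideanMulVec_smul, ← euclideanMulVec_mul,
      hWV]
    rw [euclideanMulVec_mul, norm_euclideanMulVec hV]
  rw [angularElliptical_eq_map, Measure.map_map (continuous_euclideanMulVec V).measurable
    (measurable_normalizedImage W), hcomm, ← Measure.map_map (measurable_normalizedImage W)
    (continuous_euclideanMulVec V').measurable, uniformSphere_map_euclideanMulVec hV']

theorem ae_euclideanMulVec_ne_zero {p q : ℕ} {W : Matrix (Fin p) (Fin q) ℂ}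
    (hW : W * W.conjTranspose = 1) (j : Fin p) :
    ∀ᵐ u ∂uniformSphere q, euclideanMulVec W u j ≠ 0 := by
  let K : Submodule ℝ (EuclideanSpace ℂ (Fin q)) :=
    { carrier := {u | euclideanMulVec W u j = 0}
      add_mem' := by
        intro a b ha hb
        simp only [Set.mem_ofPred_eq] at ha hb ⊢
        rw [euclideanMulVec_add, PiLp.add_apply, ha, hb, add_zero]
      zero_mem' := by simp
      smul_mem' := by
        intro r a ha
        simp only [Set.mem_ofPred_eq] at ha ⊢
        rw [euclideanMulVec_smul, PiLp.smul_apply, ha, smul_zero] }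
  have hK : K ≠ ⊤ := by
    intro h
    -- The vector `Wᴴ e_j` lies outside `K`, since `W Wᴴ e_j = e_j`.
    have : euclideanMulVec W (euclideanMulVec W.conjTranspose (EuclideanSpace.single j 1)) j = 0 := by
      have h2 : euclideanMulVec W.conjTranspose (EuclideanSpace.single j 1) ∈ K := h ▸ trivial
      exact h2
    rw [← euclideanMulVec_mul, hW] at this
    simp [euclideanMulVec] at this
  have := uniformSphere_submodule K hK
  rw [ae_iff]
  simp only [not_not]
  exact this

theorem angularElliptical_ae_ne_zero {p q : ℕ} {W : Matrix (Fin p) (Fin q) ℂ}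
    (hW : W * W.conjTranspose = 1) (j : Fin p) :
    ∀ᵐ z ∂angularElliptical W, z j ≠ 0 := by
  rw [angularElliptical_eq_map, ae_map_iff (measurable_normalizedImage W).aemeasurable]
  · filter_upwards [ae_euclideanMulVec_ne_zero hW j] with u hu
    have : euclideanMulVec W u ≠ 0 := fun h => hu (by simp [h])
    simp [normalizedImage, hu, this]
  · have : Measurable fun z : EuclideanSpace ℂ (Fin p) => z j := by fun_prop
    exact this (measurableSet_singleton 0).compl

theorem angularElliptical_ae_norm {p q : ℕ} {W : Matrix (Fin p) (Fin q) ℂ}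
    (hW : W * W.conjTranspose = 1) (hp : 0 < p) :
    ∀ᵐ z ∂angularElliptical W, ‖z‖ = 1 := by
  rw [angularElliptical_eq_map, ae_map_iff (measurable_normalizedImage W).aemeasurable
    (measurableSet_eq_fun measurable_norm measurable_const)]
  filter_upwards [ae_euclideanMulVec_ne_zero hW ⟨0, hp⟩] with u hu
  have : euclideanMulVec W u ≠ 0 := fun h => hu (by simp [h])
  simp [normalizedImage, norm_smul, this]

/-! ### Moments of the central law -/

theorem integral_angularElliptical_comp {p q : ℕ} {W : Matrix (Fin p) (Fin q) ℂ}
    (hW : W * W.conjTranspose = 1) {V : Matrix (Fin p) (Fin p) ℂ} (hV : V.conjTranspose * V = 1)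
    {g : EuclideanSpace ℂ (Fin p) → ℝ} (hg : Continuous g) :
    ∫ z, g (euclideanMulVec V z) ∂angularElliptical W = ∫ z, g z ∂angularElliptical W := by
  conv_rhs => rw [← angularElliptical_map_euclideanMulVec hW hV]
  rw [integral_map (continuous_euclideanMulVec V).measurable.aemeasurable hg.aestronglyMeasurable]

theorem integrable_angularElliptical {p q : ℕ} {W : Matrix (Fin p) (Fin q) ℂ}
    (hW : W * W.conjTranspose = 1) (hp : 0 < p) [IsProbabilityMeasure (angularElliptical W)]
    {g : EuclideanSpace ℂ (Fin p) → ℝ} (hg : Continuous g) :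
    Integrable g (angularElliptical W) := by
  obtain ⟨C, hC⟩ := (isCompact_closedBall (0 : EuclideanSpace ℂ (Fin p)) 1).exists_bound_of_continuousOn
    hg.continuousOn
  refine Integrable.of_bound hg.aestronglyMeasurable C ?_
  filter_upwards [angularElliptical_ae_norm hW hp] with z hz
  exact hC z (by simp [hz])

/-- Transposition matrices are unitary, so all coordinates have the same second moment, and these
moments sum to `E‖z‖² = 1`. -/
theorem integral_norm_coord_sq {p q : ℕ} {W : Matrix (Fin p) (Fin q) ℂ}
    (hW : W * W.conjTranspose = 1) [IsProbabilityMeasure (angularElliptical W)] (j : Fin p) :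
    ∫ z, ‖z j‖ ^ 2 ∂angularElliptical W = 1 / p := by
  have hp : 0 < p := j.pos
  have hperm : ∀ k, ∫ z, ‖z k‖ ^ 2 ∂angularElliptical W = ∫ z, ‖z j‖ ^ 2 ∂angularElliptical W := by
    intro k
    have hV : ((Equiv.swap j k).permMatrix ℂ).conjTranspose * (Equiv.swap j k).permMatrix ℂ = 1 := by
      rw [Matrix.conjTranspose_permMatrix, ← Matrix.permMatrix_mul]
      simp
    rw [← integral_angularElliptical_comp hW hV (g := fun z => ‖z j‖ ^ 2) (by fun_prop)]
    simp [euclideanMulVec, Matrix.permMatrix_mulVec]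
  have hsum : ∑ k, ∫ z, ‖z k‖ ^ 2 ∂angularElliptical W = 1 := by
    rw [← integral_finsetSum _ fun k _ => integrable_angularElliptical hW hp (by fun_prop)]
    rw [integral_congr_ae (g := fun _ => (1 : ℝ))]
    · simp
    · filter_upwards [angularElliptical_ae_norm hW hp] with z hz
      rw [← EuclideanSpace.norm_sq_eq, hz, one_pow]
  simp only [hperm, Finset.sum_const, Finset.card_univ, Fintype.card_fin, nsmul_eq_mul] at hsum
  rw [eq_div_iff (by positivity), mul_comm, hsum]

/-- Flipping the sign of coordinate `k` is unitary and negates the integrand. A real functional `φ`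
covers real and imaginary parts at once. -/
theorem integral_coord_mul_star {p q : ℕ} {W : Matrix (Fin p) (Fin q) ℂ}
    (hW : W * W.conjTranspose = 1) {j k : Fin p} (hjk : j ≠ k) (φ : ℂ →L[ℝ] ℝ) :
    ∫ z, φ (z j * star (z k)) ∂angularElliptical W = 0 := by
  have hV : (Matrix.diagonal fun i => if i = k then (-1 : ℂ) else 1).conjTranspose *
      (Matrix.diagonal fun i => if i = k then (-1 : ℂ) else 1) = 1 := by
    rw [Matrix.diagonal_conjTranspose, Matrix.diagonal_mul_diagonal, ← Matrix.diagonal_one]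
    congr 1
    ext i
    by_cases h : i = k <;> simp [h]
  have hg : Continuous fun z : EuclideanSpace ℂ (Fin p) => φ (z j * star (z k)) := by fun_prop
  have h := integral_angularElliptical_comp hW hV hg
  simp only [euclideanMulVec, Matrix.mulVec_diagonal, hjk, if_true, if_false, one_mul, neg_mul,
    star_neg, mul_neg, map_neg, integral_neg] at h
  linarith

/-- The weight is strictly below one wherever `z k ≠ 0`, and both coordinates are almost surely
nonzero. This strictness is what rules out distinct eigenvalues. -/
theorem integral_norm_sq_div_lt {p q : ℕ} {W : Matrix (Fin p) (Fin q) ℂ}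
    (hW : W * W.conjTranspose = 1) [IsProbabilityMeasure (angularElliptical W)] (j k : Fin p)
    {κ : ℝ} (hκ : 0 < κ) :
    ∫ z, ‖z j‖ ^ 2 / (1 + κ * ‖z k‖ ^ 2) ∂angularElliptical W < (1 / p : ℝ) := by
  have hpos : ∀ z : EuclideanSpace ℂ (Fin p), 0 < 1 + κ * ‖z k‖ ^ 2 := fun z => by positivity
  have hc : Continuous fun z : EuclideanSpace ℂ (Fin p) => ‖z j‖ ^ 2 / (1 + κ * ‖z k‖ ^ 2) :=
    Continuous.div (by fun_prop) (by fun_prop) fun z => (hpos z).ne'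
  have hc' : Continuous fun z : EuclideanSpace ℂ (Fin p) => ‖z j‖ ^ 2 := by fun_prop
  rw [← integral_norm_coord_sq hW j]
  have hi := integrable_angularElliptical hW j.pos hc
  have hi' := integrable_angularElliptical hW j.pos hc'
  rw [← sub_pos, ← integral_sub hi' hi]
  have hlt : ∀ z : EuclideanSpace ℂ (Fin p), z j ≠ 0 → z k ≠ 0 →
      0 < ‖z j‖ ^ 2 - ‖z j‖ ^ 2 / (1 + κ * ‖z k‖ ^ 2) := by
    intro z hj hk
    have h1 : 0 < ‖z j‖ ^ 2 := by positivity
    have h2 : 0 < κ * ‖z k‖ ^ 2 := by positivity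
    rw [sub_pos, div_lt_iff₀ (hpos z)]
    nlinarith
  have hae : ∀ᵐ z ∂angularElliptical W,
      0 < ‖z j‖ ^ 2 - ‖z j‖ ^ 2 / (1 + κ * ‖z k‖ ^ 2) := by
    filter_upwards [angularElliptical_ae_ne_zero hW j, angularElliptical_ae_ne_zero hW k]
      with z hj hk using hlt z hj hk
  rw [integral_pos_iff_support_of_nonneg_ae (hae.mono fun z hz => hz.le) (hi'.sub hi)]
  refine pos_iff_ne_zero.2 fun h0 => ?_
  obtain ⟨z, hz, hz'⟩ := (hae.and (measure_eq_zero_iff_ae_notMem.1 h0)).exists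
  exact hz' hz.ne'

/-! ### Upper bounds on the multipliers -/

theorem outerSelf_smul {p : ℕ} (r : ℝ) (x : EuclideanSpace ℂ (Fin p)) :
    outerSelf (r • x) = r ^ 2 • outerSelf x := by
  ext i j
  simp [outerSelf, Matrix.vecMulVec_apply]
  ring

theorem outerSelf_euclideanMulVec {m n : ℕ} (M : Matrix (Fin m) (Fin n) ℂ)
    (x : EuclideanSpace ℂ (Fin n)) :
    outerSelf (euclideanMulVec M x) = M * outerSelf x * M.conjTranspose := by
  simp only [outerSelf, euclideanMulVec]
  rw [Matrix.mul_vecMulVec, Matrix.vecMulVec_mul, Matrix.star_mulVec]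

theorem mul_sq_le_of_posSemidef {p : ℕ} {M : Matrix (Fin p) (Fin p) ℂ} {c : ℝ}
    {x : EuclideanSpace ℂ (Fin p)} (h : (M - c • outerSelf x).PosSemidef) (s : Fin p → ℂ) :
    c * ‖star x.ofLp ⬝ᵥ s‖ ^ 2 ≤ (star s ⬝ᵥ M.mulVec s).re := by
  have h1 := (Complex.le_def.1 (h.dotProduct_mulVec_nonneg s)).1
  have h2 : star s ⬝ᵥ (outerSelf x).mulVec s = ((‖star x.ofLp ⬝ᵥ s‖ ^ 2 : ℝ) : ℂ) := by
    rw [outerSelf, Matrix.vecMulVec_mulVec]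
    have h3 : star s ⬝ᵥ x.ofLp = star (star x.ofLp ⬝ᵥ s) := by
      rw [Matrix.star_dotProduct]
    rw [dotProduct_smul, h3, op_smul_eq_mul, RCLike.star_def, Complex.conj_mul']
    norm_cast
  rw [Matrix.sub_mulVec, Matrix.smul_mulVec, dotProduct_sub, dotProduct_smul, h2] at h1
  simp only [Complex.zero_re, Complex.sub_re, Complex.real_smul, ← Complex.ofReal_mul,
    Complex.ofReal_re] at h1
  linarith

/-- Test the constraint on `s = c a`, where `c` is `1 + κ` at coordinate `k` and `1` elsewhere. Then
`aᴴ s = ∑ c |a|² = D`, and `l c ≤ b` gives `∑ l |s|² ≤ b D`, so the diagonal part bounds `e` by `p b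
/ D`. Unlike the test vector `C⁻¹ a`, this one allows `C` to be singular. -/
theorem multiplier_le_of_posSemidef {p : ℕ} (hp : 0 < p) {C : Matrix (Fin p) (Fin p) ℂ} {e : ℝ}
    {a : EuclideanSpace ℂ (Fin p)} (ha : ‖a‖ = 1)
    (h : (C - (1 / (p : ℝ) * e) • outerSelf a).PosSemidef) {l : Fin p → ℝ} {b κ : ℝ} {k : Fin p}
    (hl : ∀ i, l i ≤ b) (hκ : 0 ≤ κ) (hκ1 : κ ≤ 1) (hk : l k * (1 + κ) ≤ b) :
    e ≤ p * b / (1 + κ * ‖a k‖ ^ 2) +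
      4 * p * ∑ i, ∑ j, ‖C i j - Matrix.diagonal (fun i => (l i : ℂ)) i j‖ := by
  set c : Fin p → ℝ := fun i => 1 + if i = k then κ else 0 with hc
  set s : Fin p → ℂ := fun i => (c i : ℂ) * a i with hs
  set D : ℝ := 1 + κ * ‖a k‖ ^ 2 with hD
  set δ : ℝ := ∑ i, ∑ j, ‖C i j - Matrix.diagonal (fun i => (l i : ℂ)) i j‖ with hδ
  have hδ0 : 0 ≤ δ := by positivity
  have hp' : (0 : ℝ) < p := by exact_mod_cast hp
  have hD1 : 1 ≤ D := by
    have : 0 ≤ κ * ‖a k‖ ^ 2 := by positivity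
    linarith
  have hsum : ∑ i, ‖a i‖ ^ 2 = 1 := by rw [← EuclideanSpace.norm_sq_eq, ha, one_pow]
  have hc1 : ∀ i, 1 ≤ c i ∧ c i ≤ 2 ∧ l i * c i ≤ b := by
    intro i
    by_cases hi : i = k
    · subst hi
      simp only [hc, if_true]
      exact ⟨by linarith, by linarith, hk⟩
    · simp only [hc, if_neg hi, add_zero, mul_one]
      exact ⟨le_rfl, by norm_num, hl i⟩
  have hcsum : ∑ i, c i * ‖a i‖ ^ 2 = D := by
    simp only [hc, add_mul, Finset.sum_add_distrib, one_mul, hsum, ite_mul, zero_mul,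
      Finset.sum_ite_eq', Finset.mem_univ, if_true, hD]
  have hdot : star a.ofLp ⬝ᵥ s = (D : ℂ) := by
    rw [← hcsum, dotProduct]
    push_cast
    refine Finset.sum_congr rfl fun i _ => ?_
    rw [hs, Pi.star_apply, RCLike.star_def, mul_left_comm, Complex.conj_mul']
  have hsn : ∀ i, ‖s i‖ ≤ 2 := by
    intro i
    have h1 : ‖a i‖ ≤ 1 := ha ▸ PiLp.norm_apply_le a i
    have h2 : ‖s i‖ = c i * ‖a i‖ := by
      rw [hs, norm_mul, Complex.norm_real, Real.norm_of_nonneg (by linarith [(hc1 i).1])]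
    rw [h2]
    nlinarith [(hc1 i).1, (hc1 i).2.1, norm_nonneg (a i)]
  have hquad := mul_sq_le_of_posSemidef h s
  rw [hdot, Complex.norm_real, Real.norm_of_nonneg (by linarith)] at hquad
  have hsplit : (star s ⬝ᵥ C.mulVec s).re
      = ∑ i, l i * ‖s i‖ ^ 2
        + (∑ i, ∑ j, star (s i) * (C i j - Matrix.diagonal (fun i => (l i : ℂ)) i j) * s j).re := by
    have : star s ⬝ᵥ C.mulVec s = ((∑ i, l i * ‖s i‖ ^ 2 : ℝ) : ℂ)
        + ∑ i, ∑ j, star (s i) * (C i j - Matrix.diagonal (fun i => (l i : ℂ)) i j) * s j := by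
      push_cast
      rw [dotProduct, ← Finset.sum_add_distrib]
      refine Finset.sum_congr rfl fun i _ => ?_
      simp only [mul_sub, sub_mul, Finset.sum_sub_distrib, Matrix.mulVec, dotProduct,
        Finset.mul_sum, Matrix.diagonal_apply, mul_ite, ite_mul, mul_zero, zero_mul,
        Finset.sum_ite_eq, Finset.mem_univ, if_true, Pi.star_apply, mul_assoc]
      rw [← Complex.conj_mul', RCLike.star_def]
      ring
    rw [this, Complex.add_re, Complex.ofReal_re]
  have hmain : ∑ i, l i * ‖s i‖ ^ 2 ≤ b * D := by
    rw [← hcsum, Finset.mul_sum]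
    refine Finset.sum_le_sum fun i _ => ?_
    have h2 : ‖s i‖ = c i * ‖a i‖ := by
      rw [hs, norm_mul, Complex.norm_real, Real.norm_of_nonneg (by linarith [(hc1 i).1])]
    have h3 : l i * ‖s i‖ ^ 2 = (l i * c i) * (c i * ‖a i‖ ^ 2) := by rw [h2]; ring
    rw [h3]
    exact mul_le_mul_of_nonneg_right (hc1 i).2.2
      (mul_nonneg (by linarith [(hc1 i).1]) (sq_nonneg _))
  -- The factor `4` comes from `‖s i‖ ≤ 2`, used for both indices.
  have herr : (∑ i, ∑ j, star (s i) * (C i j - Matrix.diagonal (fun i => (l i : ℂ)) i j) * s j).re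
      ≤ 4 * δ := by
    refine (Complex.re_le_norm _).trans ?_
    rw [hδ, Finset.mul_sum]
    refine norm_sum_le_of_le _ fun i _ => ?_
    rw [Finset.mul_sum]
    refine norm_sum_le_of_le _ fun j _ => ?_
    rw [norm_mul, norm_mul, norm_star]
    have h1 := mul_le_mul (hsn i) (hsn j) (norm_nonneg _) zero_le_two
    have h2 := norm_nonneg (C i j - Matrix.diagonal (fun i => (l i : ℂ)) i j)
    nlinarith
  have hfin : e * D ^ 2 ≤ p * (b * D + 4 * δ) := by
    have : 1 / (p : ℝ) * e * D ^ 2 ≤ b * D + 4 * δ := by linarith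
    calc e * D ^ 2 = p * (1 / (p : ℝ) * e * D ^ 2) := by field_simp
      _ ≤ _ := mul_le_mul_of_nonneg_left this hp'.le
  have hD0 : 0 < D := by linarith
  have h5 : e ≤ p * (b * D + 4 * δ) / D ^ 2 := (le_div_iff₀ (by positivity)).2 hfin
  refine h5.trans ?_
  have h6 : p * (b * D + 4 * δ) / D ^ 2 = p * b / D + 4 * p * δ / D ^ 2 := by
    field_simp
  rw [h6]
  have h7 : 4 * p * δ / D ^ 2 ≤ 4 * p * δ := div_le_self (by positivity) (one_le_pow₀ hD1)
  linarith

/-- If matrices converge to a diagonal matrix whose largest entry `l j` exceeds the entry `l k`,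
while being asymptotically averages of rank-one minorants, then the weighted second moment
of the `j`-th coordinate is at least `1 / p`. -/
theorem one_div_le_of_tendsto_diagonal {p : ℕ} {F : Filter ℕ} [F.NeBot] (hF : F ≤ atTop)
    {C : ℕ → Matrix (Fin p) (Fin p) ℂ} {a : ℕ → EuclideanSpace ℂ (Fin p)}
    (ha : ∀ i, ‖a i‖ = 1) {e : (n : ℕ) → Fin n → ℝ} {l : Fin p → ℝ} {j k : Fin p} {κ G : ℝ}
    (hC : Tendsto C F (𝓝 (Matrix.diagonal fun i => (l i : ℂ))))
    (hlmi : ∀ᶠ n in F, ∀ i : Fin n, (C n - (1 / (p : ℝ) * e n i) • outerSelf (a i)).PosSemidef)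
    (herr : Tendsto (fun n => C n - (1 / (n : ℝ)) • ∑ i, e n i • outerSelf (a i)) F (𝓝 0))
    (hl : ∀ i, l i ≤ l j) (hj : 0 < l j) (hκ : 0 ≤ κ) (hκ1 : κ ≤ 1) (hk : l k * (1 + κ) ≤ l j)
    (hG : Tendsto (fun n : ℕ => (∑ i ∈ Finset.range n, ‖a i j‖ ^ 2 / (1 + κ * ‖a i k‖ ^ 2)) / (n : ℝ))
      atTop (𝓝 G)) :
    1 / (p : ℝ) ≤ G := by
  have hp : 0 < p := j.pos
  have hp' : (0 : ℝ) < p := by exact_mod_cast hp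
  set δ : ℕ → ℝ := fun n =>
    ∑ i, ∑ j, ‖C n i j - Matrix.diagonal (fun i => (l i : ℂ)) i j‖ with hδ
  have hentry : ∀ {M : ℕ → Matrix (Fin p) (Fin p) ℂ} {M' : Matrix (Fin p) (Fin p) ℂ},
      Tendsto M F (𝓝 M') → ∀ i j, Tendsto (fun n => M n i j) F (𝓝 (M' i j)) := fun h i j =>
    ((continuous_id.matrix_elem i j).tendsto _).comp h
  have hδ0 : Tendsto δ F (𝓝 0) := by
    have : Tendsto δ F (𝓝 (∑ i : Fin p, ∑ j : Fin p, ‖Matrix.diagonal (fun i => (l i : ℂ)) i j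
        - Matrix.diagonal (fun i => (l i : ℂ)) i j‖)) :=
      tendsto_finsetSum _ fun i _ => tendsto_finsetSum _ fun j _ =>
        ((hentry hC i j).sub_const _).norm
    simpa using this
  have h1 : Tendsto (fun n => ((C n - (1 / (n : ℝ)) • ∑ i, e n i • outerSelf (a i)) j j).re) F
      (𝓝 0) := (Complex.continuous_re.tendsto _).comp (hentry herr j j)
  have h2 : Tendsto (fun n => (C n j j).re) F (𝓝 (l j)) := by
    have := (Complex.continuous_re.tendsto _).comp (hentry hC j j)
    simpa [Function.comp_def] using this
  have h3 : ∀ᶠ n in F, (C n j j).re - ((C n - (1 / (n : ℝ)) • ∑ i, e n i • outerSelf (a i)) j j).re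
      ≤ p * l j * ((∑ i ∈ Finset.range n, ‖a i j‖ ^ 2 / (1 + κ * ‖a i k‖ ^ 2)) / n)
        + 4 * p * δ n := by
    filter_upwards [hlmi, hF (eventually_gt_atTop 0)] with n hn hn0
    have hn0' : (0 : ℝ) < n := by exact_mod_cast hn0
    have e1 : (C n j j).re - ((C n - (1 / (n : ℝ)) • ∑ i, e n i • outerSelf (a i)) j j).re
        = (∑ i : Fin n, e n i * ‖a i j‖ ^ 2) / n := by
      have : ∀ i : Fin n, (outerSelf (a i) j j).re = ‖a i j‖ ^ 2 := by
        intro i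
        rw [outerSelf, Matrix.vecMulVec_apply, Pi.star_apply, RCLike.star_def, Complex.mul_conj']
        norm_cast
      simp only [Matrix.sub_apply, Matrix.smul_apply, Matrix.sum_apply, Complex.sub_re,
        Complex.smul_re, Complex.re_sum, this, smul_eq_mul]
      ring
    rw [e1, ← Fin.sum_univ_eq_sum_range
      (fun i => ‖a i j‖ ^ 2 / (1 + κ * ‖a i k‖ ^ 2)) n, div_le_iff₀ hn0']
    have e2 : (p * l j * ((∑ i : Fin n, ‖a i j‖ ^ 2 / (1 + κ * ‖a i k‖ ^ 2)) / n)
        + 4 * p * δ n) * n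
        = ∑ i : Fin n, (p * l j * (‖a i j‖ ^ 2 / (1 + κ * ‖a i k‖ ^ 2)) + 4 * p * δ n) := by
      rw [Finset.sum_add_distrib, ← Finset.mul_sum]
      simp only [Finset.sum_const, Finset.card_univ, Fintype.card_fin, nsmul_eq_mul]
      field_simp
    rw [e2]
    refine Finset.sum_le_sum fun i _ => ?_
    have e3 := multiplier_le_of_posSemidef hp (ha i) (hn i) hl hκ hκ1 hk
    have e4 : ‖a i j‖ ^ 2 ≤ 1 := by
      have := PiLp.norm_apply_le (a i) j
      rw [ha i] at this
      exact pow_le_one₀ (norm_nonneg _) this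
    have e5 : 0 ≤ δ n := by positivity
    calc e n i * ‖a i j‖ ^ 2
        ≤ (p * l j / (1 + κ * ‖a i k‖ ^ 2) + 4 * p * δ n) * ‖a i j‖ ^ 2 :=
          mul_le_mul_of_nonneg_right e3 (sq_nonneg _)
      _ = p * l j * (‖a i j‖ ^ 2 / (1 + κ * ‖a i k‖ ^ 2)) + (4 * p * δ n) * ‖a i j‖ ^ 2 := by ring
      _ ≤ _ := by
          have e6 : 4 * p * δ n * ‖a i j‖ ^ 2 ≤ 4 * p * δ n :=
            mul_le_of_le_one_right (by positivity) e4
          linarith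
  -- In the limit, `l j ≤ p * l j * G`.
  have h4 := le_of_tendsto_of_tendsto (h2.sub h1)
    (((hG.mono_left hF).const_mul (p * l j)).add (hδ0.const_mul (4 * (p : ℝ)))) h3
  rw [sub_zero, mul_zero, add_zero] at h4
  rw [div_le_iff₀ hp']
  have h5 : l j * 1 ≤ l j * (G * p) := by linarith
  exact le_of_mul_le_mul_left h5 hj

/-! ### Norms on the matrix space -/

section Seminorm

variable {p : ℕ} (N : Seminorm ℝ (Matrix (Fin p) (Fin p) ℂ))

theorem continuous_seminorm_matrix : Continuous N := by
  classical
  let b := Module.finBasis ℝ (Matrix (Fin p) (Fin p) ℂ)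
  have hle : ∀ M, N M ≤ ∑ i, |b.equivFun M i| * N (b i) := by
    intro M
    conv_lhs => rw [← b.sum_equivFun M]
    refine (Finset.le_sum_of_subadditive N (map_zero N).le (map_add_le_add N) _ _).trans (Finset.sum_le_sum fun i _ => ?_)
    rw [map_smul_eq_mul, Real.norm_eq_abs]
  have hb : Continuous b.equivFun := b.equivFun.toLinearMap.continuous_of_finiteDimensional
  rw [continuous_iff_continuousAt]
  intro M₀
  have h1 : Tendsto (fun M => ∑ i, |b.equivFun (M - M₀) i| * N (b i)) (𝓝 M₀) (𝓝 0) := by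
    have : Continuous fun M => ∑ i, |b.equivFun (M - M₀) i| * N (b i) := by
      refine continuous_finsetSum _ fun i _ => ?_
      exact (((continuous_apply i).comp
        (hb.comp (continuous_id.sub continuous_const))).abs).mul continuous_const
    simpa using this.tendsto M₀
  rw [ContinuousAt, tendsto_iff_dist_tendsto_zero]
  refine squeeze_zero (fun _ => dist_nonneg) (fun M => ?_) h1
  rw [Real.dist_eq]
  exact (abs_sub_map_le_sub N M M₀).trans (hle _)

variable {N}

/-- Convergence in a norm on matrices implies entrywise convergence. -/
theorem tendsto_zero_of_norm_tendsto_zero (hN : ∀ M, N M = 0 → M = 0) {ι : Type*} {F : Filter ι}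
    {M : ι → Matrix (Fin p) (Fin p) ℂ} (h : Tendsto (fun n => N (M n)) F (𝓝 0)) :
    Tendsto M F (𝓝 0) := by
  let : NormedAddCommGroup (Matrix (Fin p) (Fin p) ℂ) := Matrix.normedAddCommGroup
  let : NormedSpace ℝ (Matrix (Fin p) (Fin p) ℂ) := Matrix.normedSpace
  -- The constant is the minimum of `N` on the compact unit sphere of the entrywise sup norm.
  obtain ⟨c, hc, hle⟩ : ∃ c : ℝ, 0 < c ∧ ∀ M, c * ‖M‖ ≤ N M := by
    rcases subsingleton_or_nontrivial (Matrix (Fin p) (Fin p) ℂ) with hs | hs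
    · exact ⟨1, one_pos, fun M => by simp [Subsingleton.elim M 0]⟩
    · have hcont : Continuous N := continuous_seminorm_matrix N
      obtain ⟨M₀, hM₀, hmin⟩ := (isCompact_sphere (0 : Matrix (Fin p) (Fin p) ℂ) 1).exists_isMinOn
        (NormedSpace.sphere_nonempty.2 zero_le_one) hcont.continuousOn
      have hne : M₀ ≠ 0 := by
        rintro rfl
        simp at hM₀
      refine ⟨N M₀, (apply_nonneg N M₀).lt_of_ne fun h0 => hne (hN _ h0.symm), fun M => ?_⟩
      rcases eq_or_ne M 0 with rfl | hM
      · simp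
      · have hM' : ‖M‖ ≠ 0 := norm_ne_zero_iff.2 hM
        have h1 : N M₀ ≤ N (‖M‖⁻¹ • M) := hmin (by simp [norm_smul, hM'])
        rw [map_smul_eq_mul, norm_inv, norm_norm] at h1
        calc N M₀ * ‖M‖ ≤ ‖M‖⁻¹ * N M * ‖M‖ := by gcongr
          _ = N M := by field_simp
  refine tendsto_zero_iff_norm_tendsto_zero.2 ?_
  refine squeeze_zero (fun _ => norm_nonneg _) (fun n => ?_) (by simpa using h.div_const c)
  rw [le_div_iff₀ hc, mul_comm]
  exact hle _

end Seminorm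

/-! ### Positive semidefinite matrices: compactness and rank-one minorants -/

open scoped MatrixOrder Matrix.Norms.L2Operator in
theorem exists_eq_conjTranspose_mul_self {p : ℕ} {M : Matrix (Fin p) (Fin p) ℂ}
    (h : M.PosSemidef) : ∃ Q : Matrix (Fin p) (Fin p) ℂ, M = Q.conjTranspose * Q :=
  CStarAlgebra.nonneg_iff_eq_star_mul_self.1 h.nonneg

/-- In a Gram factorization `Qᴴ Q` the trace is the sum of all `|Q l i|²`, which dominates the
products forming any single entry. -/
theorem norm_apply_le_trace {p : ℕ} {M : Matrix (Fin p) (Fin p) ℂ} (h : M.PosSemidef)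
    (i j : Fin p) : ‖M i j‖ ≤ M.trace.re := by
  obtain ⟨Q, rfl⟩ := exists_eq_conjTranspose_mul_self h
  have htr : (Q.conjTranspose * Q).trace.re = ∑ l, ∑ i, ‖Q l i‖ ^ 2 := by
    rw [Finset.sum_comm, Matrix.trace, Complex.re_sum]
    refine Finset.sum_congr rfl fun i _ => ?_
    rw [Matrix.diag_apply, Matrix.mul_apply, Complex.re_sum]
    refine Finset.sum_congr rfl fun l _ => ?_
    rw [Matrix.conjTranspose_apply, RCLike.star_def, Complex.conj_mul']
    norm_cast
  rw [htr, Matrix.mul_apply]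
  refine norm_sum_le_of_le _ fun l _ => ?_
  rw [norm_mul, Matrix.conjTranspose_apply, norm_star]
  have h1 : ∀ i, ‖Q l i‖ ^ 2 ≤ ∑ i, ‖Q l i‖ ^ 2 := fun i =>
    Finset.single_le_sum (f := fun i => ‖Q l i‖ ^ 2) (fun _ _ => sq_nonneg _) (Finset.mem_univ i)
  nlinarith [h1 i, h1 j, sq_nonneg (‖Q l i‖ - ‖Q l j‖)]

theorem trace_eq_ofReal_re {p : ℕ} {M : Matrix (Fin p) (Fin p) ℂ} (h : M.PosSemidef) :
    M.trace = (M.trace.re : ℂ) :=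
  Complex.ext rfl (Complex.le_def.1 h.trace_nonneg).2.symm

theorem isClosed_setOf_posSemidef {p : ℕ} :
    IsClosed {M : Matrix (Fin p) (Fin p) ℂ | M.PosSemidef} := by
  simp only [Matrix.posSemidef_iff_dotProduct_mulVec, Set.ofPred_and, Set.ofPred_forall]
  refine IsClosed.inter ?_ (isClosed_iInter fun s => ?_)
  · exact isClosed_eq continuous_id.matrix_conjTranspose continuous_id
  · exact isClosed_le continuous_const
      (continuous_const.dotProduct (continuous_id.matrix_mulVec continuous_const))

theorem isCompact_posSemidef_trace {p : ℕ} (t : ℂ) :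
    IsCompact {M : Matrix (Fin p) (Fin p) ℂ | M.PosSemidef ∧ M.trace = t} := by
  have hK : IsCompact (Set.univ.pi fun _ : Fin p => Set.univ.pi fun _ : Fin p =>
      Metric.closedBall (0 : ℂ) t.re) :=
    isCompact_univ_pi fun _ => isCompact_univ_pi fun _ => isCompact_closedBall _ _
  refine IsCompact.of_isClosed_subset (X := Matrix (Fin p) (Fin p) ℂ) hK
    (isClosed_setOf_posSemidef.inter (isClosed_eq continuous_id.matrix_trace continuous_const)) ?_
  rintro M ⟨hM, rfl⟩ i - j -
  simpa using norm_apply_le_trace hM i j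

/-- For `u = w / ‖w‖` the matrix `1 - u uᴴ` is a Hermitian idempotent, hence of the form `Pᴴ P`. For
`w = 0` the inverse norm is `0`, so nothing is subtracted. -/
theorem posSemidef_one_sub_outerSelf {p : ℕ} (w : EuclideanSpace ℂ (Fin p)) :
    (1 - ((‖w‖⁻¹) ^ 2) • outerSelf w).PosSemidef := by
  rw [← outerSelf_smul]
  set u := ‖w‖⁻¹ • w with hu
  have hH : (outerSelf u).conjTranspose = outerSelf u := by
    simp [outerSelf, Matrix.conjTranspose_vecMulVec]
  have hI : outerSelf u * outerSelf u = outerSelf u := by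
    rcases eq_or_ne w 0 with rfl | hw
    · have : u = 0 := by simp [hu]
      simp [this, outerSelf]
    · have hnorm : ‖u‖ = 1 := by simp [hu, norm_smul, hw]
      have h := norm_sq_eq_dotProduct u
      rw [hnorm] at h
      simp only [outerSelf]
      rw [Matrix.vecMulVec_mul_vecMulVec, ← h]
      simp
  have : (1 : Matrix (Fin p) (Fin p) ℂ) - outerSelf u
      = (1 - outerSelf u).conjTranspose * (1 - outerSelf u) := by
    rw [Matrix.conjTranspose_sub, hH, Matrix.conjTranspose_one]
    simp only [sub_mul, mul_sub, one_mul, mul_one, hI]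
    simp
  rw [this]
  exact Matrix.posSemidef_conjTranspose_mul_self _

theorem posSemidef_sub_outerSelf {p : ℕ} {L Li Θ₀ : Matrix (Fin p) (Fin p) ℂ}
    (hΘ₀ : Θ₀ = L * L.conjTranspose) (hLi : L * Li = 1) (x : EuclideanSpace ℂ (Fin p)) :
    (Θ₀ - ((‖euclideanMulVec Li x‖⁻¹) ^ 2) • outerSelf x).PosSemidef := by
  have h := (posSemidef_one_sub_outerSelf (euclideanMulVec Li x)).mul_mul_conjTranspose_same L
  have h2 : L * outerSelf (euclideanMulVec Li x) * L.conjTranspose = outerSelf x := by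
    rw [← outerSelf_euclideanMulVec, ← euclideanMulVec_mul, hLi]
    simp [euclideanMulVec]
  rwa [mul_sub, sub_mul, mul_one, mul_smul_comm, smul_mul_assoc, h2, ← hΘ₀] at h

theorem exists_cholesky {p : ℕ} {Θ₀ : Matrix (Fin p) (Fin p) ℂ} (h : Θ₀.PosDef) :
    ∃ L Li : Matrix (Fin p) (Fin p) ℂ, Θ₀ = L * L.conjTranspose ∧ L * Li = 1 ∧ Li * L = 1 := by
  obtain ⟨Q, hQ⟩ := exists_eq_conjTranspose_mul_self h.posSemidef
  have hu : IsUnit (Q.conjTranspose) := by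
    have := h.isUnit
    rw [hQ] at this
    exact isUnit_of_mul_isUnit_left this
  obtain ⟨u, hu⟩ := hu
  refine ⟨Q.conjTranspose, (↑u⁻¹ : Matrix (Fin p) (Fin p) ℂ), by simpa using hQ, ?_, ?_⟩
  · rw [← hu]; simp
  · rw [← hu]; simp

/-! ### Convergence to the shape matrix -/

/-- A direction sequence has the empirical law `ν`, tested on continuous functions. -/
structure HasEmpiricalLaw {E : Type*} [NormedAddCommGroup E] [MeasurableSpace E] (z : ℕ → E)
    (ν : Measure E) : Prop where
  norm_eq : ∀ i, ‖z i‖ = 1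
  tendsto : ∀ g : E → ℝ, Continuous g →
    Tendsto (fun n : ℕ => (∑ i ∈ Finset.range n, g (z i)) / n) atTop (𝓝 (∫ z, g z ∂ν))

theorem HasEmpiricalLaw.tendsto_average_outerSelf {p q : ℕ} {W : Matrix (Fin p) (Fin q) ℂ}
    (hW : W * W.conjTranspose = 1) [IsProbabilityMeasure (angularElliptical W)]
    {z : ℕ → EuclideanSpace ℂ (Fin p)} (hz : HasEmpiricalLaw z (angularElliptical W)) :
    Tendsto (fun n : ℕ => (1 / (n : ℝ)) • ∑ i : Fin n, (p : ℝ) • outerSelf (z i)) atTop (𝓝 1) := by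
  have key : ∀ (φ : ℂ →L[ℝ] ℝ) (j k : Fin p),
      Tendsto (fun n : ℕ => φ (((1 / (n : ℝ)) • ∑ i : Fin n, (p : ℝ) • outerSelf (z i)) j k)) atTop
        (𝓝 (φ ((1 : Matrix (Fin p) (Fin p) ℂ) j k))) := by
    intro φ j k
    have hp : (p : ℝ) ≠ 0 := by exact_mod_cast j.pos.ne'
    have h1 := (hz.tendsto (fun z => φ (z j * star (z k))) (by fun_prop)).const_mul (p : ℝ)
    have h2 : (p : ℝ) * ∫ z, φ (z j * star (z k)) ∂angularElliptical W
        = φ ((1 : Matrix (Fin p) (Fin p) ℂ) j k) := by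
      by_cases hjk : j = k
      · subst hjk
        have : ∀ z : EuclideanSpace ℂ (Fin p), φ (z j * star (z j)) = ‖z j‖ ^ 2 * φ 1 := by
          intro z
          rw [RCLike.star_def, Complex.mul_conj', ← smul_eq_mul, ← map_smul]
          congr 1
          simp
        simp only [this]
        rw [integral_mul_const, integral_norm_coord_sq hW, Matrix.one_apply_eq]
        field_simp
      · rw [integral_coord_mul_star hW hjk, Matrix.one_apply_ne hjk, mul_zero, map_zero]
    rw [h2] at h1
    refine h1.congr fun n => ?_
    rw [← Fin.sum_univ_eq_sum_range (fun i => φ (z i j * star (z i k))) n]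
    simp only [Matrix.smul_apply, Matrix.sum_apply, map_smul, map_sum, outerSelf,
      Matrix.vecMulVec_apply, Pi.star_apply, smul_eq_mul, ← Finset.mul_sum]
    ring
  refine tendsto_pi_nhds.2 fun j => tendsto_pi_nhds.2 fun k => ?_
  have h1 := (Complex.continuous_ofReal.tendsto _).comp (key Complex.reCLM j k)
  have h2 := (Complex.continuous_ofReal.tendsto _).comp (key Complex.imCLM j k)
  have h3 := h1.add (h2.mul_const Complex.I)
  simpa only [Function.comp_def, Complex.reCLM_apply, Complex.imCLM_apply, Complex.re_add_im]
    using h3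

/-- If matrices of constant trace dominate rank-one terms in the directions of an angular
elliptical sample and are asymptotically the averages of these terms, they converge to the
shape matrix. -/
theorem HasEmpiricalLaw.tendsto_shape {p q : ℕ} {W : Matrix (Fin p) (Fin q) ℂ}
    (hW : W * W.conjTranspose = 1) [IsProbabilityMeasure (angularElliptical W)]
    {z : ℕ → EuclideanSpace ℂ (Fin p)} (hz : HasEmpiricalLaw z (angularElliptical W))
    {L Li Θ₀ : Matrix (Fin p) (Fin p) ℂ} (hΘ₀ : Θ₀ = L * L.conjTranspose) (hLi : L * Li = 1)
    (htr : 0 < Θ₀.trace.re) {y : ℕ → EuclideanSpace ℂ (Fin p)} {r : ℕ → ℝ}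
    (hy : ∀ i, euclideanMulVec Li (y i) = r i • z i)
    {Θ : ℕ → Matrix (Fin p) (Fin p) ℂ} {d : (n : ℕ) → Fin n → ℝ}
    (hΘ : ∀ᶠ n in atTop, (Θ n).PosSemidef ∧ (Θ n).trace = Θ₀.trace)
    (hlmi : ∀ᶠ n in atTop, ∀ i : Fin n,
      (Θ n - (1 / (p : ℝ) * d n i) • outerSelf (y i)).PosSemidef)
    (herr : Tendsto (fun n => Θ n - (1 / (n : ℝ)) • ∑ i, d n i • outerSelf (y i)) atTop (𝓝 0)) :
    Tendsto Θ atTop (𝓝 Θ₀) := by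
  refine (isCompact_posSemidef_trace Θ₀.trace).tendsto_nhds_of_unique_mapClusterPt hΘ ?_
  rintro T ⟨hTpsd, hTtr⟩ hcl
  -- An ultrafilter plays the role of a subsequence converging to `T`.
  obtain ⟨F, hF, hT⟩ := mapClusterPt_iff_ultrafilter.1 hcl
  have hB := hTpsd.mul_mul_conjTranspose_same Li
  set B := Li * T * Li.conjTranspose with hBdef
  set l := hB.isHermitian.eigenvalues with hl
  set U := (hB.isHermitian.eigenvectorUnitary : Matrix (Fin p) (Fin p) ℂ) with hU
  have hUU : U * U.conjTranspose = 1 := Unitary.coe_mul_star_self hB.isHermitian.eigenvectorUnitary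
  have hUU' : U.conjTranspose * U = 1 := mul_eq_one_comm.1 hUU
  have hspec : B = U * Matrix.diagonal (fun i => (l i : ℂ)) * U.conjTranspose := by
    have := hB.isHermitian.spectral_theorem
    rw [Unitary.conjStarAlgAut_apply] at this
    exact this
  set G := U.conjTranspose * Li with hG
  have hGT : G * T * G.conjTranspose = Matrix.diagonal (fun i => (l i : ℂ)) := by
    have h1 : G * T * G.conjTranspose = U.conjTranspose * B * U := by
      rw [hG, hBdef, Matrix.conjTranspose_mul, Matrix.conjTranspose_conjTranspose]
      simp only [Matrix.mul_assoc]
    rw [h1, hspec]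
    calc _ = (U.conjTranspose * U) * Matrix.diagonal (fun i => (l i : ℂ))
          * (U.conjTranspose * U) := by simp only [Matrix.mul_assoc]
      _ = _ := by rw [hUU', one_mul, mul_one]
  have hl0 : ∀ i, 0 ≤ l i := hB.eigenvalues_nonneg
  have hp : 0 < p := by
    rcases Nat.eq_zero_or_pos p with rfl | hp
    · simp [Matrix.trace] at htr
    · exact hp
  have : Nonempty (Fin p) := ⟨⟨0, hp⟩⟩
  obtain ⟨j, hj⟩ := Finite.exists_max l
  have hconj : Continuous fun M : Matrix (Fin p) (Fin p) ℂ => G * M * G.conjTranspose := by fun_prop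
  have hconst : ∀ k, l k = l j := by
    intro k
    by_contra hne
    have hlt : l k < l j := lt_of_le_of_ne (hj k) hne
    have hjpos : 0 < l j := (hl0 k).trans_lt hlt
    -- Dividing by `l j` rather than `l k` covers `l k = 0` and ensures `κ ≤ 1`.
    set κ : ℝ := (l j - l k) / l j with hκ
    have hκ0 : 0 < κ := div_pos (sub_pos.2 hlt) hjpos
    have hκ1 : κ ≤ 1 := (div_le_one hjpos).2 (by linarith [hl0 k])
    have hκl : l k * (1 + κ) ≤ l j := by
      have : l k * (1 + κ) = l j - (l j - l k) ^ 2 / l j := by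
        rw [hκ]; field_simp; ring
      rw [this]
      have : 0 ≤ (l j - l k) ^ 2 / l j := by positivity
      linarith
    have hUs : U.conjTranspose.conjTranspose * U.conjTranspose = 1 := by
      rw [Matrix.conjTranspose_conjTranspose, hUU]
    have hgc : Continuous fun z : EuclideanSpace ℂ (Fin p) =>
        ‖z j‖ ^ 2 / (1 + κ * ‖z k‖ ^ 2) :=
      Continuous.div (by fun_prop) (by fun_prop) fun z => by positivity
    have hlim := hz.tendsto _ (hgc.comp (continuous_euclideanMulVec U.conjTranspose))
    simp only [Function.comp_apply] at hlim
    rw [integral_angularElliptical_comp hW hUs hgc] at hlim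
    have houter : ∀ i, G * outerSelf (y i) * G.conjTranspose
        = r i ^ 2 • outerSelf (euclideanMulVec U.conjTranspose (z i)) := by
      intro i
      rw [← outerSelf_euclideanMulVec, hG, euclideanMulVec_mul, hy, euclideanMulVec_smul,
        outerSelf_smul]
    have hge := one_div_le_of_tendsto_diagonal (F := F) hF
      (C := fun n => G * Θ n * G.conjTranspose)
      (a := fun i => euclideanMulVec U.conjTranspose (z i))
      (fun i => by rw [norm_euclideanMulVec hUs, hz.norm_eq])
      (e := fun n i => d n i * r i ^ 2) (l := l) (j := j) (k := k) (κ := κ)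
      (by rw [← hGT]; exact (hconj.tendsto T).comp hT)
      (by
        filter_upwards [hF hlmi] with n hn i
        have := (hn i).mul_mul_conjTranspose_same G
        rwa [mul_sub, sub_mul, mul_smul_comm, smul_mul_assoc, houter, smul_smul,
          mul_assoc (1 / (p : ℝ))] at this)
      (by
        have := ((hconj.tendsto 0).comp herr).mono_left hF
        rw [mul_zero, zero_mul] at this
        refine this.congr fun n => ?_
        simp only [Function.comp_apply, mul_sub, sub_mul, mul_smul_comm, smul_mul_assoc,
          Finset.mul_sum, Finset.sum_mul, houter, smul_smul])
      hj hjpos hκ0.le hκ1 hκl hlim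
    exact absurd (integral_norm_sq_div_lt hW j k hκ0) (not_lt.2 hge)
  have hBl : B = (l j : ℂ) • (1 : Matrix (Fin p) (Fin p) ℂ) := by
    have : (Matrix.diagonal fun i => (l i : ℂ)) = (l j : ℂ) • (1 : Matrix (Fin p) (Fin p) ℂ) := by
      simp only [hconst]
      rw [Matrix.smul_one_eq_diagonal]
    rw [hspec, this, mul_smul_comm, mul_one, smul_mul_assoc, hUU]
  have hTl : T = (l j : ℂ) • Θ₀ := by
    have h1 : L * B * L.conjTranspose = T := by
      have : L * B * L.conjTranspose = (L * Li) * T * (L * Li).conjTranspose := by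
        rw [hBdef, Matrix.conjTranspose_mul]
        simp only [Matrix.mul_assoc]
      rw [this, hLi]
      simp
    rw [← h1, hBl, mul_smul_comm, mul_one, smul_mul_assoc, hΘ₀]
  have htr0 : Θ₀.trace ≠ 0 := fun h => by simp [h] at htr
  have hone : (l j : ℂ) = 1 := by
    rw [hTl, Matrix.trace_smul, smul_eq_mul] at hTtr
    exact mul_right_cancel₀ htr0 (by rw [hTtr, one_mul])
  rw [hTl, hone, one_smul]

/-! ### Existence and asymptotics of COCA estimates -/

theorem exists_isCOCAFeasible {p n : ℕ} {S : Set (Matrix (Fin p) (Fin p) ℂ)}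
    {Θ₀ : Matrix (Fin p) (Fin p) ℂ} (hΘ₀ : Θ₀.PosDef) (hS : Θ₀ ∈ S)
    (y : Fin n → EuclideanSpace ℂ (Fin p)) : ∃ d, IsCOCAFeasible S y Θ₀ d := by
  rcases Nat.eq_zero_or_pos p with rfl | hp
  · refine ⟨fun _ => 1, hS, fun i => ?_, fun i => one_pos⟩
    rw [Subsingleton.elim (Θ₀ - _) 0]
    exact Matrix.PosSemidef.zero
  · have hp' : (0 : ℝ) < p := by exact_mod_cast hp
    obtain ⟨L, Li, hL, hLi, -⟩ := exists_cholesky hΘ₀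
    have h : ∀ i, ∃ d : ℝ, 0 < d ∧ (Θ₀ - (1 / (p : ℝ) * d) • outerSelf (y i)).PosSemidef := by
      intro i
      have h1 := posSemidef_sub_outerSelf hL hLi (y i)
      rcases eq_or_ne (euclideanMulVec Li (y i)) 0 with h0 | h0
      · have hy : y i = 0 := by
          have : euclideanMulVec L (euclideanMulVec Li (y i)) = y i := by
            rw [← euclideanMulVec_mul, hLi]
            simp [euclideanMulVec]
          rw [← this, h0, euclideanMulVec_zero]
        -- A zero sample imposes no constraint, so any positive multiplier serves.
        refine ⟨1, one_pos, ?_⟩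
        simpa [hy, outerSelf] using hΘ₀.posSemidef
      · refine ⟨p * (‖euclideanMulVec Li (y i)‖⁻¹) ^ 2, by positivity, ?_⟩
        rwa [← mul_assoc, one_div, inv_mul_cancel₀ hp'.ne', one_mul]
    choose d hd hd' using h
    exact ⟨d, hS, hd', hd⟩

/-- COCA estimates exist for every sample sequence. -/
theorem exists_isCOCASequence {p : ℕ} (N : Seminorm ℝ (Matrix (Fin p) (Fin p) ℂ))
    {S : Set (Matrix (Fin p) (Fin p) ℂ)} {Θ₀ : Matrix (Fin p) (Fin p) ℂ} (hΘ₀ : Θ₀.PosDef)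
    (hS : Θ₀ ∈ S) (y : ℕ → EuclideanSpace ℂ (Fin p)) : ∃ Θ, IsCOCASequence N S y Θ := by
  have h : ∀ n : ℕ, ∃ (Θ : Matrix (Fin p) (Fin p) ℂ) (d : Fin n → ℝ),
      IsCOCASolution N S (fun i : Fin n => y i) (1 / ((n : ℝ) + 1)) Θ d := by
    intro n
    set A : Set ℝ := {t | ∃ Θ d, IsCOCAFeasible S (fun i : Fin n => y i) Θ d ∧
      cocaObjective N (fun i : Fin n => y i) Θ d = t} with hA
    have hne : A.Nonempty := by
      obtain ⟨d, hd⟩ := exists_isCOCAFeasible hΘ₀ hS (fun i : Fin n => y i)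
      exact ⟨_, Θ₀, d, hd, rfl⟩
    have hbdd : BddBelow A := ⟨0, by
      rintro _ ⟨Θ, d, -, rfl⟩
      exact apply_nonneg N _⟩
    obtain ⟨_, ⟨Θ, d, hfeas, rfl⟩, hlt⟩ :=
      Real.lt_sInf_add_pos hne (Nat.one_div_pos_of_nat (α := ℝ) (n := n))
    refine ⟨Θ, d, hfeas, fun Θ' d' h' => hlt.le.trans ?_⟩
    gcongr
    exact csInf_le hbdd ⟨Θ', d', h', rfl⟩
  choose Θ d hd using h
  exact ⟨Θ, d, _, tendsto_one_div_add_atTop_nhds_zero_nat, Eventually.of_forall hd⟩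

/-- Along a sample whose whitened directions have the right empirical law, every sequence of COCA
estimates converges up to scale, if the traces on the structure set are bounded below. -/
theorem IsCOCASequence.tendsto_normalized {p q : ℕ} {N : Seminorm ℝ (Matrix (Fin p) (Fin p) ℂ)}
    (hN : ∀ M, N M = 0 → M = 0) {W : Matrix (Fin p) (Fin q) ℂ} (hW : W * W.conjTranspose = 1)
    [IsProbabilityMeasure (angularElliptical W)] {L Li Θ₀ : Matrix (Fin p) (Fin p) ℂ}
    (hL : Θ₀ = L * L.conjTranspose) (hLi : L * Li = 1) {y : ℕ → EuclideanSpace ℂ (Fin p)}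
    (hz : HasEmpiricalLaw (fun i => normalizedImage Li (y i)) (angularElliptical W))
    {S : Set (Matrix (Fin p) (Fin p) ℂ)} (hS₀ : Θ₀ ∈ S) (hS : ∀ Θ ∈ S, Θ.PosSemidef) {c : ℝ}
    (hc : 0 < c) (hSc : ∀ Θ ∈ S, c ≤ Θ.trace.re) {Θ : ℕ → Matrix (Fin p) (Fin p) ℂ}
    (hΘ : IsCOCASequence N S y Θ) :
    Tendsto (fun n => (Θ₀.trace / (Θ n).trace) • Θ n) atTop (𝓝 Θ₀) := by
  obtain ⟨d, ε, hε, hsol⟩ := hΘ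
  have htr : 0 < Θ₀.trace.re := hc.trans_le (hSc _ hS₀)
  have hp : 0 < p := by
    rcases Nat.eq_zero_or_pos p with rfl | hp
    · simp [Matrix.trace] at htr
    · exact hp
  have hp' : (0 : ℝ) < p := by exact_mod_cast hp
  set r : ℕ → ℝ := fun i => ‖euclideanMulVec Li (y i)‖ with hr
  have hy : ∀ i, euclideanMulVec Li (y i) = r i • normalizedImage Li (y i) := fun i =>
    (norm_smul_normalizedImage Li (y i)).symm
  have hr0 : ∀ i, 0 < r i := by
    intro i
    refine (norm_nonneg _).lt_of_ne fun h0 => ?_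
    have h1 := hz.norm_eq i
    simp [normalizedImage, norm_eq_zero.1 h0.symm] at h1
  have hout : ∀ i, L * outerSelf (normalizedImage Li (y i)) * L.conjTranspose
      = (r i)⁻¹ ^ 2 • outerSelf (y i) := by
    intro i
    have h1 : normalizedImage Li (y i) = (r i)⁻¹ • euclideanMulVec Li (y i) := rfl
    rw [← outerSelf_euclideanMulVec, h1, euclideanMulVec_smul, ← euclideanMulVec_mul, hLi,
      outerSelf_smul]
    simp [euclideanMulVec]
  have hfeas : ∀ n : ℕ, IsCOCAFeasible S (fun i : Fin n => y i) Θ₀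
      (fun i : Fin n => p * (r i)⁻¹ ^ 2) := by
    intro n
    refine ⟨hS₀, fun i => ?_, fun i => ?_⟩
    · rw [← mul_assoc, one_div, inv_mul_cancel₀ hp'.ne', one_mul]
      exact posSemidef_sub_outerSelf hL hLi (y i)
    · have := hr0 i
      positivity
  have hobj₀ : Tendsto (fun n : ℕ => cocaObjective N (fun i : Fin n => y i) Θ₀
      (fun i : Fin n => p * (r i)⁻¹ ^ 2)) atTop (𝓝 0) := by
    have h1 := hz.tendsto_average_outerSelf hW
    have h2 : Continuous fun M : Matrix (Fin p) (Fin p) ℂ => N (Θ₀ - L * M * L.conjTranspose) :=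
      (continuous_seminorm_matrix N).comp (by fun_prop)
    have h3 := (h2.tendsto 1).comp h1
    rw [mul_one, ← hL, sub_self, map_zero] at h3
    refine h3.congr fun n => ?_
    simp only [Function.comp_apply, cocaObjective, mul_smul_comm, smul_mul_assoc,
      Finset.mul_sum, Finset.sum_mul, hout, smul_smul]
  have hobj : Tendsto (fun n : ℕ => cocaObjective N (fun i : Fin n => y i) (Θ n) (d n)) atTop
      (𝓝 0) := by
    refine squeeze_zero' (Eventually.of_forall fun n => apply_nonneg N _) ?_
      (by simpa only [add_zero] using hobj₀.add hε)
    filter_upwards [hsol] with n hn using hn.le _ _ (hfeas n)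
  -- Scaling `Θ n` and the multipliers by the same `t n` preserves the constraints; as `t n ≤
  -- Θ₀.trace.re / c`, the residual still vanishes.
  set t : ℕ → ℝ := fun n => Θ₀.trace.re / (Θ n).trace.re with ht
  have htΘ : ∀ᶠ n in atTop, (Θ₀.trace / (Θ n).trace) • Θ n = t n • Θ n := by
    filter_upwards [hsol] with n hn
    rw [trace_eq_ofReal_re (hS _ hS₀), trace_eq_ofReal_re (hS _ hn.feasible.mem),
      ← Complex.ofReal_div, ht]
    ext i j
    simp
  have htpos : ∀ᶠ n in atTop, 0 < t n ∧ t n ≤ Θ₀.trace.re / c := by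
    filter_upwards [hsol] with n hn
    have h1 := hSc _ hn.feasible.mem
    exact ⟨div_pos htr (hc.trans_le h1), div_le_div_of_nonneg_left htr.le hc h1⟩
  refine Tendsto.congr' (htΘ.mono fun n hn => hn.symm) ?_
  refine hz.tendsto_shape hW hL hLi htr hy (d := fun n i => t n * d n i) ?_ ?_ ?_
  · filter_upwards [hsol, htpos] with n hn htn
    have hpsd := hS _ hn.feasible.mem
    refine ⟨hpsd.smul htn.1.le, ?_⟩
    have h1 : (Θ n).trace.re ≠ 0 := (hc.trans_le (hSc _ hn.feasible.mem)).ne'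
    rw [Matrix.trace_smul, trace_eq_ofReal_re (hS _ hS₀), trace_eq_ofReal_re hpsd,
      Complex.real_smul, ← Complex.ofReal_mul, ht]
    rw [div_mul_cancel₀ _ h1]
  · filter_upwards [hsol, htpos] with n hn htn i
    have h1 := (hn.feasible.lmi i).smul htn.1.le
    rw [smul_sub, smul_smul] at h1
    rwa [mul_left_comm]
  · refine tendsto_zero_of_norm_tendsto_zero hN ?_
    refine squeeze_zero' (Eventually.of_forall fun n => apply_nonneg N _) ?_
      (by simpa using hobj.const_mul (Θ₀.trace.re / c))
    filter_upwards [htpos] with n htn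
    have h1 : t n • Θ n - (1 / (n : ℝ)) • ∑ i : Fin n, (t n * d n i) • outerSelf (y i)
        = t n • (Θ n - (1 / (n : ℝ)) • ∑ i : Fin n, d n i • outerSelf (y i)) := by
      simp only [smul_sub, smul_comm (t n) (1 / (n : ℝ)), Finset.smul_sum, mul_smul]
    rw [h1, map_smul_eq_mul, Real.norm_of_nonneg htn.1.le]
    exact mul_le_mul_of_nonneg_right htn.2 (apply_nonneg N _)

/-! ### Consistency for both kinds of structure sets -/

/-- The trace controls every entry, so traces tending to zero would put `0` in the closed set `S`.
-/
theorem exists_pos_le_trace {p : ℕ} {S : Set (Matrix (Fin p) (Fin p) ℂ)} (hS : IsClosed S)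
    (hpsd : ∀ Θ ∈ S, Θ.PosSemidef) (h0 : 0 ∉ S) : ∃ c : ℝ, 0 < c ∧ ∀ Θ ∈ S, c ≤ Θ.trace.re := by
  by_contra! h
  choose Θ hΘ hlt using fun n : ℕ => h (1 / ((n : ℝ) + 1)) Nat.one_div_pos_of_nat
  refine h0 (hS.mem_of_tendsto (f := Θ) (b := atTop) ?_ (Eventually.of_forall hΘ))
  refine tendsto_pi_nhds.2 fun i => tendsto_pi_nhds.2 fun j => ?_
  exact squeeze_zero_norm (fun n => (norm_apply_le_trace (hpsd _ (hΘ n)) i j).trans (hlt n).le)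
    tendsto_one_div_add_atTop_nhds_zero_nat

theorem trace_eq_of_mem_affineStructure {p k : ℕ} {D₀ : Matrix (Fin p) (Fin p) ℂ}
    {D : Fin k → Matrix (Fin p) (Fin p) ℂ} (hD : ∀ i, (D i).trace = 0)
    {Θ : Matrix (Fin p) (Fin p) ℂ} (h : Θ ∈ affineStructure D₀ D) : Θ.trace = D₀.trace := by
  obtain ⟨-, a, rfl⟩ := h
  simp [Matrix.trace_add, Matrix.trace_sum, Matrix.trace_smul, hD]

/-- Almost surely, the whitened directions of an angular elliptical sample have the central
angular elliptical law as their empirical law. -/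
theorem ae_hasEmpiricalLaw {p q : ℕ} {Ω : Type*} [MeasurableSpace Ω] {μ : Measure Ω}
    [IsProbabilityMeasure μ] (hp : 0 < p) {Λ : Matrix (Fin p) (Fin q) ℂ}
    {Li : Matrix (Fin p) (Fin p) ℂ} (hW : (Li * Λ) * (Li * Λ).conjTranspose = 1)
    {x : ℕ → Ω → EuclideanSpace ℂ (Fin p)} (hlaw : ∀ i, HasLaw (x i) (angularElliptical Λ) μ)
    (hindep : iIndepFun x μ) :
    IsProbabilityMeasure (angularElliptical (Li * Λ)) ∧ ∀ᵐ ω ∂μ,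
      HasEmpiricalLaw (fun i => normalizedImage Li (x i ω)) (angularElliptical (Li * Λ)) := by
  have h1 : HasLaw (normalizedImage Li) (angularElliptical (Li * Λ)) (angularElliptical Λ) :=
    ⟨(measurable_normalizedImage Li).aemeasurable, angularElliptical_map_normalizedImage Li Λ⟩
  have h2 : ∀ i, HasLaw (normalizedImage Li ∘ x i) (angularElliptical (Li * Λ)) μ := fun i =>
    h1.comp (hlaw i)
  refine ⟨(h2 0).isProbabilityMeasure_iff.1 inferInstance, ?_⟩
  filter_upwards [ae_forall_continuous_tendsto_average h2
    (hindep.comp (fun _ => normalizedImage Li) fun _ => measurable_normalizedImage Li)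
    (angularElliptical_ae_norm hW hp)] with ω hω
  exact ⟨hω.1, hω.2⟩

/-- Strong consistency of COCA. First part: structure sets that are a trace-normalized affine
slice of the positive semidefinite cone (all their elements have the same trace). Second part:
closed convex structure sets separated from zero, up to scale. -/
theorem theorem2 {p q : ℕ} {Ω : Type*} [MeasurableSpace Ω] (μ : Measure Ω) [IsProbabilityMeasure μ]
    (N : Seminorm ℝ (Matrix (Fin p) (Fin p) ℂ)) (hN : ∀ M, N M = 0 → M = 0)
    (Θ₀ : Matrix (Fin p) (Fin p) ℂ) (hΘ₀ : Θ₀.PosDef)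
    (Λ : Matrix (Fin p) (Fin q) ℂ) (hΛ : Λ * Λ.conjTranspose = Θ₀)
    (x : ℕ → Ω → EuclideanSpace ℂ (Fin p))
    (hlaw : ∀ i, HasLaw (x i) (angularElliptical Λ) μ) (hindep : iIndepFun x μ) :
    (∀ (k : ℕ) (D₀ : Matrix (Fin p) (Fin p) ℂ) (D : Fin k → Matrix (Fin p) (Fin p) ℂ),
      D₀.PosSemidef → (∀ i, (D i).IsHermitian) → (∀ i, (D i).trace = 0) →
      Θ₀ ∈ affineStructure D₀ D →
        (∀ y, ∃ Θ, IsCOCASequence N (affineStructure D₀ D) y Θ) ∧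
        ∀ᵐ ω ∂μ, ∀ Θ : ℕ → Matrix (Fin p) (Fin p) ℂ,
          IsCOCASequence N (affineStructure D₀ D) (fun i => x i ω) Θ →
            Tendsto Θ atTop (𝓝 Θ₀)) ∧
    (∀ S : Set (Matrix (Fin p) (Fin p) ℂ),
      IsClosed S → Convex ℝ S → (∀ Θ ∈ S, Θ.PosSemidef) → 0 ∉ S → Θ₀ ∈ S →
        (∀ y, ∃ Θ, IsCOCASequence N S y Θ) ∧
        ∀ᵐ ω ∂μ, ∀ Θ : ℕ → Matrix (Fin p) (Fin p) ℂ,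
          IsCOCASequence N S (fun i => x i ω) Θ →
            Tendsto (fun n => (Θ₀.trace / (Θ n).trace) • Θ n) atTop (𝓝 Θ₀)) := by
  obtain ⟨L, Li, hL, hLLi, hLiL⟩ := exists_cholesky hΘ₀
  have hW : (Li * Λ) * (Li * Λ).conjTranspose = 1 := by
    calc (Li * Λ) * (Li * Λ).conjTranspose = Li * (Λ * Λ.conjTranspose) * Li.conjTranspose := by
          rw [Matrix.conjTranspose_mul]
          simp only [Matrix.mul_assoc]
      _ = (Li * L) * (Li * L).conjTranspose := by
          rw [hΛ, hL, Matrix.conjTranspose_mul]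
          simp only [Matrix.mul_assoc]
      _ = 1 := by rw [hLiL]; simp
  have main : ∀ S : Set (Matrix (Fin p) (Fin p) ℂ), Θ₀ ∈ S → (∀ Θ ∈ S, Θ.PosSemidef) →
      ∀ c : ℝ, 0 < c → (∀ Θ ∈ S, c ≤ Θ.trace.re) → 0 < p →
      ∀ᵐ ω ∂μ, ∀ Θ : ℕ → Matrix (Fin p) (Fin p) ℂ, IsCOCASequence N S (fun i => x i ω) Θ →
        Tendsto (fun n => (Θ₀.trace / (Θ n).trace) • Θ n) atTop (𝓝 Θ₀) := by
    intro S hS₀ hS c hc hSc hp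
    obtain ⟨hprob, hemp⟩ := ae_hasEmpiricalLaw hp hW hlaw hindep
    filter_upwards [hemp] with ω hω Θ hΘ
    exact hΘ.tendsto_normalized hN hW hL hLLi hω hS₀ hS hc hSc
  refine ⟨fun k D₀ D _ _ hD hmem => ⟨exists_isCOCASequence N hΘ₀ hmem, ?_⟩,
    fun S hcl _ hpsd h0 hmem => ⟨exists_isCOCASequence N hΘ₀ hmem, ?_⟩⟩
  · rcases Nat.eq_zero_or_pos p with rfl | hp
    · refine Eventually.of_forall fun ω Θ _ => ?_
      exact tendsto_const_nhds.congr fun n => Subsingleton.elim _ _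
    · have : Nonempty (Fin p) := ⟨⟨0, hp⟩⟩
      have htr : 0 < Θ₀.trace := hΘ₀.trace_pos
      have heq : ∀ Θ ∈ affineStructure D₀ D, Θ.trace = Θ₀.trace := fun Θ hΘ =>
        (trace_eq_of_mem_affineStructure hD hΘ).trans
          (trace_eq_of_mem_affineStructure hD hmem).symm
      filter_upwards [main _ hmem (fun Θ hΘ => hΘ.1) _ (Complex.lt_def.1 htr).1
        (fun Θ hΘ => by rw [heq Θ hΘ]) hp] with ω hω Θ hΘ
      refine (hω Θ hΘ).congr' ?_
      obtain ⟨d, ε, -, hsol⟩ := hΘ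
      filter_upwards [hsol] with n hn
      -- The trace is constant on the affine slice, so the normalizing factor is one.
      rw [heq _ hn.feasible.mem, div_self htr.ne', one_smul]
  · obtain ⟨c, hc, hSc⟩ := exists_pos_le_trace hcl hpsd h0
    have hp : 0 < p := by
      rcases Nat.eq_zero_or_pos p with rfl | hp
      · exact absurd (Subsingleton.elim Θ₀ 0 ▸ hmem) h0
      · exact hp
    exact main S hmem hpsd c hc hSc hp
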